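/- Work over $\mathbb{C}$ and let $n\ge -1$ be an integer. The twisted tangent bundle $T(n)=T_{\mathbb{P}^2}(n)$ is presented by the Euler sequence $0\to\mathcal{O}(n)\xrightarrow{(x_0,x_1,x_2)}\mathcal{O}(n+1)^3\to T(n)\to 0$, and $v\wedge w\in H^0(\mathbb{P}^2,\mathcal{O}(2n+3))$ denotes the wedge product of $v,w\in H^0(T(n))$ in $\det T(n)=\mathcal{O}(2n+3)$; for $v,w$ represented by vectors $f,g$ it is $\det(f,g,x)$ with $x=(x_0,x_1,x_2)$. A two-dimensional subspace $V\subset H^0(T(n))$ is called GPLI (generically pointwise linearly independent) if there are $p\in\mathbb{P}^2$ and $v_1,v_2\in V$ whose values $v_1(p),v_2(p)$ in the fibre of $T(n)$ at $p$ are linearly independent. Let $$\Phi_n:\mathrm{Gr}(2,H^0(T(n)))\dashrightarrow\mathbb{P}(H^0(\mathbb{P}^2,\mathcal{O}(2n+3))),\qquad [V]\mapsto[\textstyle\bigwedge^2V],$$ be the rational map to the projective space of lines in $H^0(\mathcal{O}(2n+3))$, defined at the GPLI subspaces, that sends $V$ to the line $L$ spanned by $v_1\wedge v_2$ for any basis $v_1,v_2$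 of $V$. **Proposition.** Let $V\subset H^0(T(n))$ be a GPLI subspace, let $L=\Phi_n(V)$, and let $C\subset\mathbb{P}^2$ be the curve (as a scheme) defined by $L$. Then $\Phi_n$ is defined near $[V]$ and differentiable at $[V]$, with a unique differential $$(d\Phi_n)_{[V]}:\mathrm{Hom}_{\mathbb{C}}(V,H^0(T(n))/V)\to \mathrm{Hom}_{\mathbb{C}}(L,H^0(\mathcal{O}(2n+3))/L)$$ between the tangent spaces. For every basis $v_1,v_2$ of $V$, with $F=v_1\wedge v_2$ the corresponding equation of $C$, the map $\psi\mapsto\psi(F)|_C$ is an isomorphism from the tangent space $\mathrm{Hom}_{\mathbb{C}}(L,H^0(\mathcal{O}(2n+3))/L)$ onto $H^0(C,\mathcal{O}_{\mathbb{P}^2}(2n+3)|_C)$, and under this identification the differential is $$(d\Phi_n)_{[V]}:\ \varphi\mapsto\bigl(v_1\wedge\varphi(v_2)-v_2\wedge\varphi(v_1)\bigr)|_C ,$$ where $\varphi(v_1),\varphi(v_2)$ may be replaced by any of their lifts to $H^0(T(n))$. The description does not depend on the basis: if $\tilde v_1,\tilde v_2$ is another basis of $V$ and $\det M$ is the determinant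 of the change of basis, then both the equation of $C$ and the expression are multiplied by $\det M$, that is, $\tilde v_1\wedge\tilde v_2=\det M\cdot(v_1\wedge v_2)$ and $$\bigl(\tilde v_1\wedge\varphi(\tilde v_2)-\tilde v_2\wedge\varphi(\tilde v_1)\bigr)|_C=\det M\cdot\bigl(v_1\wedge\varphi(v_2)-v_2\wedge\varphi(v_1)\bigr)|_C .$$ -/

import Mathlib

open scoped LinearAlgebra.Projectivization

noncomputable section

namespace PlaneTangent

/-! ### The line bundles `𝒪(d)` on the complex projective plane -/

/-- The homogeneous coordinate ring `ℂ[x₀, x₁, x₂]` of `ℙ²`. -/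
abbrev CoordRing : Type := MvPolynomial (Fin 3) ℂ

/-- The field `ℂ(x₀, x₁, x₂)`; all sections of `𝒪(d)` over nonempty open sets live in it. -/
abbrev FracField : Type := FractionRing CoordRing

/-- A polynomial, seen as a fraction. -/
abbrev toFrac : CoordRing →+* FracField := algebraMap CoordRing FracField

/-- The sections of `𝒪(d)` over `U_i ∩ U_j`, where `U_i = {x_i ≠ 0}`: the fractions
`a / (x_i x_j) ^ k` with `a` homogeneous of degree `d + 2 k`. The sections over `U_i`
are obtained for `j = i`. -/
def chartO (i j : Fin 3) (d : ℤ) : Submodule ℂ FracField where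
  carrier := {f | ∃ (k m : ℕ) (a : CoordRing), a.IsHomogeneous m ∧ (m : ℤ) = d + 2 * k ∧
    f * toFrac (MvPolynomial.X i * MvPolynomial.X j) ^ k = toFrac a}
  zero_mem' := ⟨d.natAbs, (d + 2 * d.natAbs).toNat, 0, MvPolynomial.isHomogeneous_zero _ _ _,
    by omega, by simp⟩
  add_mem' := by
    rintro f g ⟨k, m, a, ha, hm, hf⟩ ⟨l, r, b, hb, hr, hg⟩
    have hX : (MvPolynomial.X i * MvPolynomial.X j : CoordRing).IsHomogeneous 2 :=
      (MvPolynomial.isHomogeneous_X ℂ i).mul (MvPolynomial.isHomogeneous_X ℂ j)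
    refine ⟨k + l, m + 2 * l, a * (MvPolynomial.X i * MvPolynomial.X j) ^ l +
      b * (MvPolynomial.X i * MvPolynomial.X j) ^ k, ?_, by push_cast; linarith, ?_⟩
    · have h1 := ha.mul (hX.pow l)
      have h2 := hb.mul (hX.pow k)
      have : r + 2 * k = m + 2 * l := by omega
      rw [this] at h2
      exact h1.add h2
    · rw [map_add, map_mul toFrac a, map_mul toFrac b, map_pow, map_pow, ← hf, ← hg]
      ring
  smul_mem' := by
    rintro c f ⟨k, m, a, ha, hm, hf⟩
    refine ⟨k, m, MvPolynomial.C c * a, by simpa using (MvPolynomial.isHomogeneous_C _ c).mul ha,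
      hm, ?_⟩
    rw [map_mul toFrac (MvPolynomial.C c) a, ← hf, smul_mul_assoc, Algebra.smul_def]
    rfl

theorem mul_mem_chartO {i j : Fin 3} {d e : ℤ} {f g : FracField} (hf : f ∈ chartO i j d)
    (hg : g ∈ chartO i j e) : f * g ∈ chartO i j (d + e) := by
  obtain ⟨k, m, a, ha, hm, hf⟩ := hf
  obtain ⟨l, r, b, hb, hr, hg⟩ := hg
  refine ⟨k + l, m + r, a * b, ha.mul hb, by push_cast; linarith, ?_⟩
  rw [map_mul toFrac a b, ← hf, ← hg]
  ring

theorem one_mem_chartO (i j : Fin 3) : (1 : FracField) ∈ chartO i j 0 :=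
  ⟨0, 0, 1, MvPolynomial.isHomogeneous_one _ _, by simp, by simp⟩

theorem X_mem_chartO (i j l : Fin 3) : toFrac (MvPolynomial.X l) ∈ chartO i j 1 :=
  ⟨0, 1, MvPolynomial.X l, MvPolynomial.isHomogeneous_X _ _, by simp, by simp⟩

/-- `H⁰(ℙ², 𝒪(d))`: the elements of the function field that are sections of `𝒪(d)` over each
of the charts `U₀, U₁, U₂`. -/
def H0O (d : ℤ) : Submodule ℂ FracField := ⨅ i, chartO i i d

/-! ### The twisted tangent bundle `T(n)`

The Euler sequence `0 → 𝒪(n) → 𝒪(n+1)³ → T(n) → 0`, with first map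
`f ↦ (f x₀, f x₁, f x₂)`, presents `T(n)`. -/

/-- The vector `(x₀, x₁, x₂)`. -/
def euler : Fin 3 → FracField := fun i => toFrac (MvPolynomial.X i)

/-- The generic stalk of `T(n)`: rational vectors modulo multiples of `(x₀, x₁, x₂)`. -/
abbrev TGeneric : Type := (Fin 3 → FracField) ⧸ Submodule.span FracField {euler}

/-- The class of a rational vector in the generic stalk. -/
def tmk : (Fin 3 → FracField) →ₗ[FracField] TGeneric :=
  (Submodule.span FracField {euler}).mkQ

/-- The sections of `T(n)` over `U_i`: the classes of the sections of `𝒪(n+1)³` over `U_i`. -/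
def chartT (i : Fin 3) (n : ℤ) : Submodule ℂ TGeneric :=
  (Submodule.pi Set.univ (fun _ : Fin 3 => chartO i i (n + 1))).map (tmk.restrictScalars ℂ)

/-- `H⁰(ℙ², T(n))`: the elements of the generic stalk that are sections of `T(n)` over each
of the charts `U₀, U₁, U₂`. -/
def H0T (n : ℤ) : Submodule ℂ TGeneric := ⨅ i, chartT i n

/-- The value of the section `v` of `T(n)` at the point `P` is `w`: near `P`, on a chart `U_i`,
`v` is the class of `a / x_i ^ k`, and `w` is the class of the value of this vector at
homogeneous coordinates `p` of `P`, in the fibre `ℂ³ / ℂ p`. -/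
def HasValueAt (n : ℤ) (v : H0T n) (P : ℙ ℂ (Fin 3 → ℂ))
    (w : (Fin 3 → ℂ) ⧸ Submodule.span ℂ {P.rep}) : Prop :=
  ∃ (i : Fin 3) (k m : ℕ) (a : Fin 3 → CoordRing),
    P.rep i ≠ 0 ∧ (∀ j, (a j).IsHomogeneous m) ∧ (m : ℤ) = n + 1 + k ∧
    (v : TGeneric) = tmk (fun j => toFrac (a j) / toFrac (MvPolynomial.X i) ^ k) ∧
    w = Submodule.Quotient.mk (fun j => MvPolynomial.eval P.rep (a j) / P.rep i ^ k)

/-- The two-dimensional subspaces of `H⁰(T(n))` that are generically pointwise linearly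
independent (GPLI): there is a point at which two members have independent values. -/
def GPLI (n : ℤ) : Set (Submodule ℂ (H0T n)) :=
  {V | Module.finrank ℂ V = 2 ∧ ∃ (P : ℙ ℂ (Fin 3 → ℂ)), ∃ v₁ ∈ V, ∃ v₂ ∈ V, ∃ w₁ w₂,
    HasValueAt n v₁ P w₁ ∧ HasValueAt n v₂ P w₂ ∧ LinearIndependent ℂ ![w₁, w₂]}

/-! ### The wedge product `T(n) × T(n) → det T(n) = 𝒪(2n+3)` -/

/-- `(a, b) ↦ det (a, b, (x₀, x₁, x₂))`. -/
def detForm : (Fin 3 → FracField) →ₗ[FracField] (Fin 3 → FracField) →ₗ[FracField] FracField :=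
  LinearMap.mk₂ FracField (fun a b => Matrix.det (Matrix.of ![a, b, euler]))
    (by intro a a' b; simp [Matrix.det_fin_three]; ring)
    (by intro c a b; simp [Matrix.det_fin_three]; ring)
    (by intro a b b'; simp [Matrix.det_fin_three]; ring)
    (by intro c a b; simp [Matrix.det_fin_three]; ring)

theorem detForm_apply (a b : Fin 3 → FracField) :
    detForm a b = Matrix.det (Matrix.of ![a, b, euler]) := rfl

/-- The determinant form descends to classes modulo `(x₀, x₁, x₂)`. -/
def wedgeGeneric : TGeneric →ₗ[FracField] TGeneric →ₗ[FracField] FracField :=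
  Submodule.liftQ _
    { toFun := fun a => Submodule.liftQ _ (detForm a) (by
        rw [Submodule.span_singleton_le_iff_mem, LinearMap.mem_ker, detForm_apply,
          Matrix.det_fin_three]
        simp; ring)
      map_add' := by
        intro a b; apply Submodule.linearMap_qext; refine LinearMap.ext fun c => ?_
        simp
      map_smul' := by
        intro a b; apply Submodule.linearMap_qext; refine LinearMap.ext fun c => ?_
        simp }
    (by
      rw [Submodule.span_singleton_le_iff_mem, LinearMap.mem_ker]
      apply Submodule.linearMap_qext
      refine LinearMap.ext fun b => ?_
      change detForm euler b = 0
      rw [detForm_apply, Matrix.det_fin_three]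
      simp; ring)

theorem wedgeGeneric_tmk (a b : Fin 3 → FracField) :
    wedgeGeneric (tmk a) (tmk b) = Matrix.det (Matrix.of ![a, b, euler]) := rfl

theorem wedgeGeneric_mem (n : ℤ) {v w : TGeneric} (hv : v ∈ H0T n) (hw : w ∈ H0T n) :
    wedgeGeneric v w ∈ H0O (2 * n + 3) := by
  rw [H0T, Submodule.mem_iInf] at hv hw
  rw [H0O, Submodule.mem_iInf]
  intro i
  obtain ⟨a, ha, rfl⟩ := hv i
  obtain ⟨b, hb, rfl⟩ := hw i
  have ha' : ∀ j, a j ∈ chartO i i (n + 1) := fun j => ha j (Set.mem_univ j)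
  have hb' : ∀ j, b j ∈ chartO i i (n + 1) := fun j => hb j (Set.mem_univ j)
  have key : ∀ p q r, a p * b q * euler r ∈ chartO i i (2 * n + 3) := by
    intro p q r
    have h := mul_mem_chartO (mul_mem_chartO (ha' p) (hb' q)) (X_mem_chartO i i r)
    have e : n + 1 + (n + 1) + 1 = 2 * n + 3 := by ring
    rw [e] at h
    exact h
  change wedgeGeneric (tmk a) (tmk b) ∈ _
  rw [wedgeGeneric_tmk, Matrix.det_fin_three]
  simp only [Matrix.of_apply, Matrix.cons_val]
  refine Submodule.sub_mem _ (Submodule.add_mem _ (Submodule.add_mem _ (Submodule.sub_mem _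
    (Submodule.sub_mem _ (key 0 1 2) (key 0 2 1)) ?_) ?_) ?_) ?_
  · exact (mul_comm (b 0) (a 1)) ▸ key 1 0 2
  · refine cast (congrArg (· ∈ chartO i i (2 * n + 3)) ?_) (key 1 2 0)
    ring
  · refine cast (congrArg (· ∈ chartO i i (2 * n + 3)) ?_) (key 2 0 1)
    ring
  · refine cast (congrArg (· ∈ chartO i i (2 * n + 3)) ?_) (key 2 1 0)
    ring

/-- The wedge product `H⁰(T(n)) × H⁰(T(n)) → H⁰(𝒪(2n+3))`. -/
def wedge (n : ℤ) : H0T n →ₗ[ℂ] H0T n →ₗ[ℂ] H0O (2 * n + 3) :=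
  LinearMap.mk₂ ℂ (fun v w => ⟨wedgeGeneric v w, wedgeGeneric_mem n v.2 w.2⟩)
    (by intro v v' w; ext; simp)
    (by
      intro c v w; apply Subtype.ext
      change wedgeGeneric (c • (v : TGeneric)) w = c • wedgeGeneric v w
      rw [← algebraMap_smul FracField c (v : TGeneric), map_smul, LinearMap.smul_apply,
        algebraMap_smul])
    (by intro v w w'; ext; simp)
    (by
      intro c v w; apply Subtype.ext
      change wedgeGeneric v (c • (w : TGeneric)) = c • wedgeGeneric v w
      rw [← algebraMap_smul FracField c (w : TGeneric), map_smul, algebraMap_smul])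

theorem wedge_coe (n : ℤ) (v w : H0T n) : (wedge n v w : FracField) = wedgeGeneric v w := rfl

/-! ### The rational map `V ↦ [⋀² V]` -/

/-- The image of `⋀² V` in `H⁰(𝒪(2n+3))`. -/
def wedgeLine (n : ℤ) (V : Submodule ℂ (H0T n)) : Submodule ℂ (H0O (2 * n + 3)) :=
  Submodule.span ℂ {f | ∃ v ∈ V, ∃ w ∈ V, f = wedge n v w}

theorem wedge_self (n : ℤ) (v : H0T n) : wedge n v v = 0 := by
  apply Subtype.ext
  obtain ⟨a, ha⟩ := Submodule.mkQ_surjective _ (v : TGeneric)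
  rw [wedge_coe, ← ha]
  change wedgeGeneric (tmk a) (tmk a) = 0
  rw [wedgeGeneric_tmk]
  exact Matrix.det_zero_of_row_eq (i := 0) (j := 1) (by decide) rfl

theorem wedge_ne_zero (n : ℤ) {v₁ v₂ : H0T n} {P : ℙ ℂ (Fin 3 → ℂ)}
    {w₁ w₂ : (Fin 3 → ℂ) ⧸ Submodule.span ℂ {P.rep}} (h₁ : HasValueAt n v₁ P w₁)
    (h₂ : HasValueAt n v₂ P w₂) (h : LinearIndependent ℂ ![w₁, w₂]) : wedge n v₁ v₂ ≠ 0 := by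
  obtain ⟨i, k, m, a, hi, -, -, hv, rfl⟩ := h₁
  obtain ⟨j, l, r, b, hj, -, -, hw, rfl⟩ := h₂
  intro h0
  have h0' : wedgeGeneric (v₁ : TGeneric) (v₂ : TGeneric) = 0 := by
    rw [← wedge_coe, h0]; rfl
  have hvec : ∀ (c : Fin 3 → CoordRing) (i : Fin 3) (k : ℕ),
      (fun j => toFrac (c j) / toFrac (MvPolynomial.X i) ^ k) =
      (toFrac (MvPolynomial.X i) ^ k)⁻¹ • (fun j => toFrac (c j)) := by
    intro c i k; funext j; simp [div_eq_inv_mul]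
  rw [hv, hw, hvec, hvec, map_smul, map_smul, map_smul, map_smul, LinearMap.smul_apply] at h0'
  have hX : ∀ i : Fin 3, toFrac (MvPolynomial.X i) ≠ 0 := by
    intro i hh
    exact MvPolynomial.X_ne_zero (R := ℂ) i
      ((IsFractionRing.injective CoordRing FracField) (hh.trans (map_zero _).symm))
  have h1 := (smul_eq_zero.1 ((smul_eq_zero.1 h0').resolve_left
    (inv_ne_zero (pow_ne_zero _ (hX _))))).resolve_left (inv_ne_zero (pow_ne_zero _ (hX _)))
  rw [wedgeGeneric_tmk] at h1
  -- the polynomial determinant vanishes, hence so does its value at the point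
  have h2 : Matrix.det (Matrix.of ![a, b, fun t => MvPolynomial.X t]) = 0 := by
    apply IsFractionRing.injective CoordRing FracField
    rw [map_zero, RingHom.map_det, ← h1]
    congr 1
    ext s t
    fin_cases s <;> rfl
  have h3 : Matrix.det (Matrix.of ![fun t => MvPolynomial.eval P.rep (a t),
      fun t => MvPolynomial.eval P.rep (b t), P.rep]) = 0 := by
    have h4 := congrArg (MvPolynomial.eval P.rep) h2
    rw [map_zero, RingHom.map_det] at h4
    rw [← h4]
    congr 1
    ext s t
    fin_cases s <;> simp
  obtain ⟨x, hx0, hx⟩ := Matrix.exists_vecMul_eq_zero_iff.2 h3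
  have hlin : x 0 • (fun t => MvPolynomial.eval P.rep (a t)) +
      x 1 • (fun t => MvPolynomial.eval P.rep (b t)) = - x 2 • P.rep := by
    funext t
    have := congrFun hx t
    simp [Matrix.vecMul, dotProduct, Fin.sum_univ_three] at this
    simp only [Pi.add_apply, Pi.smul_apply, smul_eq_mul, neg_mul]
    linear_combination this
  have hvec' : ∀ (c : Fin 3 → CoordRing) (z : ℂ) (k : ℕ), z ≠ 0 →
      (fun t => MvPolynomial.eval P.rep (c t)) =
      z ^ k • (fun t => MvPolynomial.eval P.rep (c t) / z ^ k) := by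
    intro c z k hz; funext t; simp; field_simp
  have hq := congrArg (Submodule.span ℂ {P.rep}).mkQ hlin
  rw [hvec' a _ k hi, hvec' b _ l hj, map_add, map_smul, map_smul, map_smul, map_smul] at hq
  have hz : (Submodule.span ℂ {P.rep}).mkQ (-x 2 • P.rep) = 0 := by
    rw [Submodule.mkQ_apply, Submodule.Quotient.mk_eq_zero]
    exact Submodule.smul_mem _ _ (Submodule.mem_span_singleton_self _)
  rw [hz, smul_smul, smul_smul] at hq
  have hpair := (LinearIndependent.pair_iff.1 h) _ _ hq
  have hx0' : x 0 = 0 := (mul_eq_zero.1 hpair.1).resolve_right (pow_ne_zero _ hi)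
  have hx1' : x 1 = 0 := (mul_eq_zero.1 hpair.2).resolve_right (pow_ne_zero _ hj)
  have hx2' : x 2 = 0 := by
    rw [hx0', hx1', zero_smul, zero_smul, zero_add] at hlin
    have := (smul_eq_zero.1 hlin.symm).resolve_right P.rep_nonzero
    simpa using this
  apply hx0
  funext s
  fin_cases s <;> assumption

theorem finrank_span_alternating {E E' : Type*} [AddCommGroup E] [Module ℂ E] [AddCommGroup E']
    [Module ℂ E'] (B : E →ₗ[ℂ] E →ₗ[ℂ] E') (hB : ∀ v, B v v = 0) (V : Submodule ℂ E)
    (hV : Module.finrank ℂ V = 2) {v₁ v₂ : E} (h₁ : v₁ ∈ V) (h₂ : v₂ ∈ V) (hne : B v₁ v₂ ≠ 0) :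
    Module.finrank ℂ (Submodule.span ℂ {f | ∃ v ∈ V, ∃ w ∈ V, f = B v w}) = 1 := by
  have hswap : ∀ v w, B w v = - B v w := by
    intro v w
    have h := hB (v + w)
    simp only [map_add, LinearMap.add_apply, hB, zero_add, add_zero] at h
    exact eq_neg_of_add_eq_zero_left h
  have hind : LinearIndependent ℂ ![v₁, v₂] := by
    rw [LinearIndependent.pair_iff]
    intro s t hst
    constructor
    · have := congrArg (fun u => B u v₂) hst
      simp only [map_add, map_smul, LinearMap.add_apply, LinearMap.smul_apply, hB,
        smul_zero, add_zero, map_zero, LinearMap.zero_apply] at this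
      exact (smul_eq_zero.1 this).resolve_right hne
    · have := congrArg (B v₁) hst
      simp only [map_add, map_smul, hB, smul_zero, zero_add, map_zero] at this
      exact (smul_eq_zero.1 this).resolve_right hne
  have hrange : Set.range ![v₁, v₂] = {v₁, v₂} := by
    simp [Matrix.range_cons, Set.pair_comm]
  have hspan : Submodule.span ℂ {v₁, v₂} = V := by
    have : FiniteDimensional ℂ V := Module.finite_of_finrank_pos (by omega)
    apply Submodule.eq_of_le_of_finrank_eq
    · rw [Submodule.span_le]
      rintro x (rfl | rfl) <;> assumption
    · rw [hV, ← hrange, finrank_span_eq_card hind]; simp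
  have heq : Submodule.span ℂ {f | ∃ v ∈ V, ∃ w ∈ V, f = B v w} =
      Submodule.span ℂ {B v₁ v₂} := by
    apply le_antisymm
    · rw [Submodule.span_le]
      rintro f ⟨v, hv, w, hw, rfl⟩
      rw [← hspan, Submodule.mem_span_pair] at hv hw
      obtain ⟨s, t, rfl⟩ := hv
      obtain ⟨s', t', rfl⟩ := hw
      refine Submodule.mem_span_singleton.2 ⟨s * t' - t * s', ?_⟩
      simp only [map_add, map_smul, LinearMap.add_apply, LinearMap.smul_apply, hB,
        hswap v₁ v₂]
      module
    · rw [Submodule.span_singleton_le_iff_mem]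
      exact Submodule.subset_span ⟨v₁, h₁, v₂, h₂, rfl⟩
  rw [heq]
  exact finrank_span_singleton hne

theorem finrank_wedgeLine (n : ℤ) (V : GPLI n) : Module.finrank ℂ (wedgeLine n V) = 1 := by
  obtain ⟨V, hV, P, v₁, h₁, v₂, h₂, w₁, w₂, hw₁, hw₂, hlin⟩ := V
  exact finrank_span_alternating (wedge n) (wedge_self n) V hV h₁ h₂
    (wedge_ne_zero n hw₁ hw₂ hlin)

/-- The map `Φ_n`, from its domain of definition (the GPLI points of the Grassmannian) to the
projective space of plane curves of degree `2n+3`: it sends `V` to the line `⋀² V`. -/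
def Phi (n : ℤ) (V : GPLI n) : ℙ ℂ (H0O (2 * n + 3)) :=
  Projectivization.mk'' (wedgeLine n V) (finrank_wedgeLine n V)

theorem wedge_mem (n : ℤ) (V : GPLI n) (v w : V.1) :
    wedge n v w ∈ (Phi n V).submodule := by
  rw [Phi, Projectivization.submodule_mk'']
  exact Submodule.subset_span ⟨v, v.2, w, w.2, rfl⟩

/-! ### Differentials of maps between Grassmannians -/

section Differential

variable {E E' : Type*} [AddCommGroup E] [Module ℂ E] [AddCommGroup E'] [Module ℂ E']

/-- The graph of a linear map `A : V → W`. If `W` is a complement of `V`, then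
`A ↦ graph V W A` is the standard affine chart of the Grassmannian centred at `V`. -/
def graph (V W : Submodule ℂ E) (A : V →ₗ[ℂ] W) : Submodule ℂ E :=
  LinearMap.range (V.subtype + W.subtype ∘ₗ A)

/-- The tangent space `Hom(V, E/V)` of the Grassmannian of `E` at `V`; for a line `V` this is
the tangent space of the projective space of lines. -/
abbrev GrTangent (V : Submodule ℂ E) : Type _ := V →ₗ[ℂ] E ⧸ V

/-- The identification of the tangent space of the chart `Hom(V, W)` at its origin with the
tangent space `Hom(V, E/V)` of the Grassmannian. -/
def chartTangent (V W : Submodule ℂ E) (A : V →ₗ[ℂ] W) : GrTangent V :=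
  V.mkQ ∘ₗ W.subtype ∘ₗ A

/-- `f`, defined on a set `U` of subspaces of `E` and with values subspaces of `E'`, is
differentiable at `V` with differential `D`: in all standard charts centred at `V` and at `f V`,
`U` contains a neighbourhood of `V`, and the expression `B` of `f` in these charts has at the
origin a Fréchet derivative `B'` which corresponds to `D`. Here `e` and `e'` are linear coordinates
on the (finite-dimensional) charts. -/
def HasDifferentialAt {U : Set (Submodule ℂ E)} (f : U → Submodule ℂ E') (V : U)
    (D : GrTangent V.1 →ₗ[ℂ] GrTangent (f V)) : Prop :=
  ∀ W : Submodule ℂ E, IsCompl V.1 W → ∀ W' : Submodule ℂ E', IsCompl (f V) W' →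
    ∃ (m m' : ℕ) (e : (Fin m → ℂ) ≃ₗ[ℂ] (V.1 →ₗ[ℂ] W)) (e' : (f V →ₗ[ℂ] W') ≃ₗ[ℂ] (Fin m' → ℂ))
      (B : (V.1 →ₗ[ℂ] W) → (f V →ₗ[ℂ] W')) (B' : (V.1 →ₗ[ℂ] W) →ₗ[ℂ] (f V →ₗ[ℂ] W')),
      (∀ᶠ x in nhds (0 : Fin m → ℂ), ∃ h : graph V.1 W (e x) ∈ U,
        f ⟨graph V.1 W (e x), h⟩ = graph (f V) W' (B (e x))) ∧
      HasFDerivAt (fun x => e' (B (e x)))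
        (LinearMap.toContinuousLinearMap (e'.toLinearMap ∘ₗ B' ∘ₗ e.toLinearMap)) 0 ∧
      ∀ A, chartTangent (f V) W' (B' A) = D (chartTangent V.1 W A)

end Differential

/-! ### Sections of `𝒪(d)` on a plane curve

`L` is a line in `H⁰(𝒪(d))`, and `C` the curve (a scheme, maybe not reduced) that it defines. -/

/-- The sections over `U_i ∩ U_j` of the twist by `d` of the ideal sheaf of `C`; if `F` spans `L`,
these are the products of `F` and a regular function on `U_i ∩ U_j`. -/
def idealO (d : ℤ) (L : Submodule ℂ (H0O d)) (i j : Fin 3) : Submodule ℂ FracField :=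
  L.map (H0O d).subtype * chartO i j 0

/-- Triples of sections of `𝒪(d)` over `U₀, U₁, U₂` that agree on `C` over all overlaps. -/
def curveCocycles (d : ℤ) (L : Submodule ℂ (H0O d)) : Submodule ℂ (Fin 3 → FracField) where
  carrier := {a | (∀ i, a i ∈ chartO i i d) ∧ ∀ i j, a i - a j ∈ idealO d L i j}
  zero_mem' := ⟨fun _ => Submodule.zero_mem _, fun i j => by simp⟩
  add_mem' := fun {a b} ha hb => ⟨fun i => Submodule.add_mem _ (ha.1 i) (hb.1 i), fun i j => by
    simpa [add_sub_add_comm] using Submodule.add_mem _ (ha.2 i j) (hb.2 i j)⟩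
  smul_mem' := fun c a ha => ⟨fun i => Submodule.smul_mem _ c (ha.1 i), fun i j => by
    simpa [smul_sub] using Submodule.smul_mem _ c (ha.2 i j)⟩

/-- `H⁰(C, 𝒪(d)|_C)`: triples of sections over `U₀, U₁, U₂` that agree on `C` over all
overlaps, modulo the triples that vanish on `C`. -/
abbrev H0Curve (d : ℤ) (L : Submodule ℂ (H0O d)) : Type :=
  curveCocycles d L ⧸
    (Submodule.pi Set.univ (fun i : Fin 3 => idealO d L i i)).comap (curveCocycles d L).subtype

/-- Restriction of global sections of `𝒪(d)` to `C`. -/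
def restrict (d : ℤ) (L : Submodule ℂ (H0O d)) : H0O d →ₗ[ℂ] H0Curve d L :=
  Submodule.mkQ _ ∘ₗ
    LinearMap.codRestrict (curveCocycles d L) (LinearMap.pi (fun _ => (H0O d).subtype))
      (fun f => ⟨fun i => (Submodule.mem_iInf _).1 f.2 i, fun i j => by simp⟩)

theorem le_ker_restrict (d : ℤ) (L : Submodule ℂ (H0O d)) :
    L ≤ LinearMap.ker (restrict d L) := by
  intro f hf
  rw [LinearMap.mem_ker, restrict, LinearMap.comp_apply, Submodule.mkQ_apply,
    Submodule.Quotient.mk_eq_zero]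
  intro i _
  have := Submodule.mul_mem_mul (Submodule.mem_map_of_mem (f := (H0O d).subtype) hf)
    (one_mem_chartO i i)
  rw [mul_one] at this
  exact this

/-- For `F` in `L`, the map from the tangent space at `L` of the projective space of plane curves
of degree `d` to `H⁰(C, 𝒪(d)|_C)` that sends `ψ ∈ Hom(L, H⁰(𝒪(d))/L)` to `ψ(F)|_C`. For `F ≠ 0`
it is the identification of the two spaces given by the equation `F` of `C`. -/
def tangentToCurve (d : ℤ) (L : Submodule ℂ (H0O d)) (F : L) :
    GrTangent L →ₗ[ℂ] H0Curve d L :=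
  L.liftQ (restrict d L) (le_ker_restrict d L) ∘ₗ LinearMap.applyₗ F

end PlaneTangent

end

/-! The differential is a computation with one alternating bilinear map `B = wedge n`. In the chart
`A ↦ graph V W A`, the plane near `V` is spanned by `b i + A (b i)`, so its image line is spanned by
`G A = B (b 0 + A (b 0)) (b 1 + A (b 1))`. This is quadratic in `A`, with constant term `F = B (b 0)
(b 1)` and linear part `B (b 0) (A (b 1)) - B (b 1) (A (b 0))`. Let `γ` be the coordinate along `F`
and `π` the projection to a complement of `L`. The line is then the graph of `F ↦ (γ G)⁻¹ • π G`; at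
the origin `γ G = 1` and `π G = 0`, so the derivative is the linear part modulo `L`
(`hasDifferentialAt_alternating`). The chart stays in the GPLI locus near `V` because a plane with a
nonzero wedge is GPLI (`mem_GPLI`).

The identification of the target with sections on `C` comes from `0 → 𝒪 → 𝒪(d) → 𝒪_C(d) → 0`, the
first map being multiplication by `F`. Restriction to `C` has kernel `L` because `H⁰(𝒪) = ℂ`
(`ker_restrict`), and is surjective because `H¹(𝒪) = 0` (`exists_coboundary`,
`restrict_surjective`).

The analysis needs finite-dimensional section spaces: sections of `𝒪(d)` are homogeneous
polynomials, and `H⁰(T(n))` embeds in `H⁰(𝒪(n+2))³` by the cross product with `x`. -/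

noncomputable section

namespace PlaneTangent

/-! ### Derivative of a quadratic map -/

section Calculus

variable {X Y : Type*} [NormedAddCommGroup X] [NormedSpace ℂ X] [FiniteDimensional ℂ X]
  [NormedAddCommGroup Y] [NormedSpace ℂ Y]

/-- A quadratic map `x ↦ y₀ + ℓ x + β x x` has derivative `ℓ` at the origin. -/
theorem hasFDerivAt_quadratic (y₀ : Y) (ℓ : X →ₗ[ℂ] Y) (β : X →ₗ[ℂ] X →ₗ[ℂ] Y) :
    HasFDerivAt (fun x => y₀ + ℓ x + β x x) (LinearMap.toContinuousLinearMap ℓ) 0 := by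
  -- Finite dimension makes `β` continuous; its product-rule terms `β 0 x` and `β x 0` vanish at the
  -- origin.
  let β' : X →L[ℂ] X →L[ℂ] Y := LinearMap.toContinuousLinearMap
    ((LinearMap.toContinuousLinearMap (𝕜 := ℂ) (E := X) (F' := Y)).toLinearMap ∘ₗ β)
  have h := β'.hasFDerivAt_of_bilinear (hasFDerivAt_id (0 : X)) (hasFDerivAt_id (0 : X))
  have h' := ((LinearMap.toContinuousLinearMap ℓ).hasFDerivAt (x := (0 : X))).const_add y₀
  have h'' := h'.add h
  refine (h''.congr_fderiv ?_)
  ext x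
  simp

end Calculus

/-! ### Grassmannian charts and uniqueness of the differential -/

section Differential

variable {E E' : Type*} [AddCommGroup E] [Module ℂ E] [AddCommGroup E'] [Module ℂ E']

theorem graph_injective {V W : Submodule ℂ E} (h : IsCompl V W) :
    Function.Injective (graph V W) := by
  intro A A' hA
  ext v
  have hv : (v : E) + A v ∈ graph V W A' := hA ▸ ⟨v, rfl⟩
  obtain ⟨u, hu⟩ := hv
  have hu' : (u : E) + A' u = v + A v := hu
  have huv : (u : E) - v = A v - A' u := by
    rw [sub_eq_sub_iff_add_eq_add, hu', add_comm]
  have h0 : (u : E) - v = 0 := by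
    have h1 : (u : E) - v ∈ V := V.sub_mem u.2 v.2
    have h2 : (u : E) - v ∈ W := huv ▸ W.sub_mem (A v).2 (A' u).2
    exact (Submodule.disjoint_def.1 h.disjoint) _ h1 h2
  have e : u = v := Subtype.ext (sub_eq_zero.1 h0)
  rw [huv, e, sub_eq_zero] at h0
  exact h0

theorem finrank_graph {V W : Submodule ℂ E} (h : IsCompl V W) (A : V →ₗ[ℂ] W) :
    Module.finrank ℂ (graph V W A) = Module.finrank ℂ V := by
  refine LinearMap.finrank_range_of_inj ?_
  rw [← LinearMap.ker_eq_bot, LinearMap.ker_eq_bot']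
  intro v hv
  have hv' : (v : E) + A v = 0 := hv
  have h2 : (v : E) ∈ W := by
    rw [eq_neg_of_add_eq_zero_left hv']
    exact W.neg_mem (A v).2
  exact Subtype.ext ((Submodule.disjoint_def.1 h.disjoint) _ v.2 h2)

theorem chartTangent_surjective {V W : Submodule ℂ E} (h : IsCompl V W) :
    Function.Surjective (chartTangent V W) := by
  intro φ
  refine ⟨(V.quotientEquivOfIsCompl W h).toLinearMap ∘ₗ φ, ?_⟩
  ext v
  exact Submodule.mk_quotientEquivOfIsCompl_apply h (φ v)

/-- A subspace determines the linear map of which it is the graph, so two chart expressions of `f`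
agree near the origin and have the same derivative. Every tangent vector comes from a chart vector,
so this derivative determines the differential. -/
theorem HasDifferentialAt.unique {U : Set (Submodule ℂ E)} {f : U → Submodule ℂ E'} {V : U}
    {D D' : GrTangent V.1 →ₗ[ℂ] GrTangent (f V)} (h : HasDifferentialAt f V D)
    (h' : HasDifferentialAt f V D') : D' = D := by
  obtain ⟨W, hW⟩ := Submodule.exists_isCompl V.1
  obtain ⟨W', hW'⟩ := Submodule.exists_isCompl (f V)
  obtain ⟨m, m', e, e', B, B', hB, hder, hD⟩ := h W hW W' hW'
  obtain ⟨r, r', d, d', C, C', hC, hder', hD'⟩ := h' W hW W' hW'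
  -- The coordinates on the charts are existential, hence may differ between the two hypotheses; `T`
  -- and `S` are the linear changes of coordinates.
  let T : (Fin m → ℂ) →L[ℂ] (Fin r → ℂ) :=
    LinearMap.toContinuousLinearMap (e.trans d.symm).toLinearMap
  let S : (Fin m' → ℂ) →L[ℂ] (Fin r' → ℂ) :=
    LinearMap.toContinuousLinearMap (e'.symm.trans d').toLinearMap
  have hT : ∀ x, d (T x) = e x := fun x => by simp [T]
  have hS : ∀ y, S (e' y) = d' y := fun y => by simp [S]
  have hT0 : T 0 = 0 := map_zero T
  have hC' := (T.continuous.tendsto' 0 0 hT0).eventually hC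
  have heq : (fun x => S (e' (B (e x)))) =ᶠ[nhds 0] fun x => d' (C (d (T x))) := by
    filter_upwards [hB, hC'] with x hx hy
    obtain ⟨h1, h2⟩ := hx
    obtain ⟨h3, h4⟩ := hy
    rw [hS, hT]
    congr 1
    apply graph_injective hW'
    rw [← h2]
    simp only [hT] at h4
    exact h4
  have k1 := S.hasFDerivAt.comp (0 : Fin m → ℂ) hder
  rw [← hT0] at hder'
  have k2 := hder'.comp (0 : Fin m → ℂ) T.hasFDerivAt
  have k3 := (k1.congr_of_eventuallyEq (f₁ := fun x => d' (C (d (T x)))) heq.symm).unique k2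
  have hBC : ∀ A, C' A = B' A := by
    intro A
    have := congrArg (fun g : (Fin m → ℂ) →L[ℂ] (Fin r' → ℂ) => g (e.symm A)) k3
    simp only [ContinuousLinearMap.comp_apply, LinearMap.coe_toContinuousLinearMap',
      LinearMap.comp_apply, LinearEquiv.coe_coe, hS, hT, LinearEquiv.apply_symm_apply] at this
    exact (d'.injective this).symm
  ext1 φ
  obtain ⟨A, rfl⟩ := chartTangent_surjective hW φ
  rw [← hD, ← hD', hBC]

end Differential

/-! ### The line spanned by an alternating form on a plane -/

section Alternating

variable {E E' : Type*} [AddCommGroup E] [Module ℂ E] [AddCommGroup E'] [Module ℂ E']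
  {B : E →ₗ[ℂ] E →ₗ[ℂ] E'}

theorem alternating_swap (hB : ∀ v, B v v = 0) (v w : E) : B w v = - B v w := by
  have h := hB (v + w)
  simp only [map_add, LinearMap.add_apply, hB, zero_add, add_zero] at h
  exact eq_neg_of_add_eq_zero_left h

theorem span_alternating_span_pair (hB : ∀ v, B v v = 0) (v₁ v₂ : E) :
    Submodule.span ℂ {f | ∃ v ∈ Submodule.span ℂ {v₁, v₂},
      ∃ w ∈ Submodule.span ℂ {v₁, v₂}, f = B v w} = Submodule.span ℂ {B v₁ v₂} := by
  apply le_antisymm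
  · rw [Submodule.span_le]
    rintro f ⟨v, hv, w, hw, rfl⟩
    rw [Submodule.mem_span_pair] at hv hw
    obtain ⟨s, t, rfl⟩ := hv
    obtain ⟨s', t', rfl⟩ := hw
    refine Submodule.mem_span_singleton.2 ⟨s * t' - t * s', ?_⟩
    simp only [map_add, map_smul, LinearMap.add_apply, LinearMap.smul_apply, hB,
      alternating_swap hB v₁ v₂]
    module
  · rw [Submodule.span_singleton_le_iff_mem]
    exact Submodule.subset_span ⟨v₁, Submodule.subset_span (by simp), v₂,
      Submodule.subset_span (by simp), rfl⟩

theorem span_basis_pair {V : Submodule ℂ E} (b : Module.Basis (Fin 2) ℂ V) :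
    Submodule.span ℂ {(b 0 : E), (b 1 : E)} = V := by
  have h := congrArg (Submodule.map V.subtype) b.span_eq
  rw [Submodule.map_span, Submodule.map_top, Submodule.range_subtype] at h
  refine Eq.trans ?_ h
  congr 1
  ext x
  simp [eq_comm]

theorem span_alternating_basis (hB : ∀ v, B v v = 0) {V : Submodule ℂ E}
    (b : Module.Basis (Fin 2) ℂ V) :
    Submodule.span ℂ {f | ∃ v ∈ V, ∃ w ∈ V, f = B v w} = Submodule.span ℂ {B (b 0) (b 1)} := by
  have h := span_alternating_span_pair hB (b 0 : E) (b 1 : E)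
  rwa [span_basis_pair b] at h

theorem graph_eq_span_pair {V W : Submodule ℂ E} (b : Module.Basis (Fin 2) ℂ V)
    (A : V →ₗ[ℂ] W) :
    graph V W A = Submodule.span ℂ {(b 0 : E) + A (b 0), (b 1 : E) + A (b 1)} := by
  rw [graph, LinearMap.range_eq_map, ← b.span_eq, Submodule.map_span]
  congr 1
  ext x
  simp [eq_comm]

/-- The expression of the map to lines in the chart `Hom(L, W')` of the projective space, where
`c F = 1` for the generator `F` of `L`. -/
theorem span_singleton_eq_graph {L W' : Submodule ℂ E'} (h : IsCompl L W') {F : E'} (hF : F ∈ L)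
    (hL : L = Submodule.span ℂ {F}) (c : L →ₗ[ℂ] ℂ) (hc : c ⟨F, hF⟩ = 1) {G : E'}
    (hG : c (L.projectionOnto W' h G) ≠ 0) :
    Submodule.span ℂ {G} = graph L W' (c.smulRight
      ((c (L.projectionOnto W' h G))⁻¹ • W'.projectionOnto L h.symm G)) := by
  have hspan : ∀ u : L, u = c u • ⟨F, hF⟩ := by
    intro u
    have hu : (u : E') ∈ Submodule.span ℂ {F} := hL ▸ u.2
    obtain ⟨t, ht⟩ := Submodule.mem_span_singleton.1 hu
    have : u = t • ⟨F, hF⟩ := Subtype.ext ht.symm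
    rw [this, map_smul, hc, smul_eq_mul, mul_one]
  set s := c (L.projectionOnto W' h G) with hs
  -- Decomposition of `G` along `L ⊕ W'`; division by `s` gives the point of the graph over `F`.
  have hGeq : G = s • F + (W'.projectionOnto L h.symm G : E') := by
    conv_lhs => rw [← Submodule.projection_add_projection_eq_self h G]
    rw [Submodule.projection_apply, Submodule.projection_apply]
    congr 1
    exact congrArg Subtype.val (hspan (L.projectionOnto W' h G))
  have hgr : ∀ u : L, (u : E') + (c.smulRight (s⁻¹ • W'.projectionOnto L h.symm G)) u =
      (c u * s⁻¹) • G := by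
    intro u
    have hu : (u : E') = c u • F := congrArg Subtype.val (hspan u)
    rw [LinearMap.smulRight_apply, Submodule.coe_smul, Submodule.coe_smul]
    conv_rhs => rw [hGeq]
    rw [smul_add, smul_smul, smul_smul, mul_assoc, inv_mul_cancel₀ hG, mul_one, ← hu]
  apply le_antisymm
  · rw [Submodule.span_singleton_le_iff_mem]
    refine ⟨s • ⟨F, hF⟩, ?_⟩
    refine (hgr (s • ⟨F, hF⟩ : L)).trans ?_
    rw [map_smul, hc, smul_eq_mul, mul_one, mul_inv_cancel₀ hG, one_smul]
  · rintro _ ⟨u, rfl⟩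
    exact Submodule.mem_span_singleton.2 ⟨_, (hgr u).symm⟩

end Alternating

/-! ### The differential of `V ↦ ⋀² V` for an alternating form -/

section Alternating

variable {E E' : Type*} [AddCommGroup E] [Module ℂ E] [AddCommGroup E'] [Module ℂ E']
  {B : E →ₗ[ℂ] E →ₗ[ℂ] E'}

/-- The linear map `B v : E / V → E' / L` for `v ∈ V`, where `L` contains `B (V × V)`. -/
def contractQ (B : E →ₗ[ℂ] E →ₗ[ℂ] E') {V : Submodule ℂ E} {L : Submodule ℂ E'}
    (h : ∀ v ∈ V, ∀ w ∈ V, B v w ∈ L) (v : V) : (E ⧸ V) →ₗ[ℂ] (E' ⧸ L) :=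
  V.mapQ L (B v) fun w hw => h v v.2 w hw

theorem contractQ_mk {V : Submodule ℂ E} {L : Submodule ℂ E'}
    (h : ∀ v ∈ V, ∀ w ∈ V, B v w ∈ L) (v : V) (w : E) :
    contractQ B h v (Submodule.Quotient.mk w) = Submodule.Quotient.mk (B v w) :=
  rfl

/-- The differential of `V ↦ ⋀² V`, where `c` is the coordinate on the line `L = ⋀² V` given by
the basis `b` of `V`. -/
def alternatingDifferential (B : E →ₗ[ℂ] E →ₗ[ℂ] E') {V : Submodule ℂ E} {L : Submodule ℂ E'}
    (h : ∀ v ∈ V, ∀ w ∈ V, B v w ∈ L) (b : Module.Basis (Fin 2) ℂ V) (c : L →ₗ[ℂ] ℂ) :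
    GrTangent V →ₗ[ℂ] GrTangent L where
  toFun φ := c.smulRight (contractQ B h (b 0) (φ (b 1)) - contractQ B h (b 1) (φ (b 0)))
  map_add' φ ψ := by
    ext u
    simp only [LinearMap.smulRight_apply, LinearMap.add_apply, map_add]
    module
  map_smul' t φ := by
    ext u
    simp only [LinearMap.smulRight_apply, LinearMap.smul_apply, map_smul, RingHom.id_apply]
    module

/-- `E` and `E'` carry no topology, so the bilinear map is only differentiated after a linear map
`P` to a normed space. This serves both for the coordinate along `F` and for the component in the
complement. -/
theorem hasFDerivAt_alternating_add {X Y : Type*} [NormedAddCommGroup X] [NormedSpace ℂ X]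
    [FiniteDimensional ℂ X] [NormedAddCommGroup Y] [NormedSpace ℂ Y]
    (B : E →ₗ[ℂ] E →ₗ[ℂ] E') (P : E' →ₗ[ℂ] Y) (v w : E) (p q : X →ₗ[ℂ] E) :
    HasFDerivAt (fun x => P (B (v + p x) (w + q x)))
      (LinearMap.toContinuousLinearMap (P ∘ₗ (B v ∘ₗ q + B.flip w ∘ₗ p))) 0 := by
  refine (hasFDerivAt_quadratic (P (B v w)) (P ∘ₗ (B v ∘ₗ q + B.flip w ∘ₗ p))
    ((B.compl₁₂ p q).compr₂ P)).congr_of_eventuallyEq (Filter.Eventually.of_forall fun x => ?_)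
  simp only [map_add, LinearMap.add_apply, LinearMap.comp_apply, LinearMap.flip_apply,
    LinearMap.compr₂_apply, LinearMap.compl₁₂_apply]
  abel

/-- Hypothesis `hU` gives the neighbourhood of `V` inside `U`: where the coordinate `γ` of the wedge
along `F` is nonzero, so is the wedge itself. -/
theorem hasDifferentialAt_alternating [FiniteDimensional ℂ E] [FiniteDimensional ℂ E']
    (hB : ∀ v, B v v = 0) {U : Set (Submodule ℂ E)}
    (hU : ∀ V : Submodule ℂ E, Module.finrank ℂ V = 2 → (∃ v ∈ V, ∃ w ∈ V, B v w ≠ 0) → V ∈ U)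
    {f : U → Submodule ℂ E'}
    (hf : ∀ V : U, f V = Submodule.span ℂ {g | ∃ v ∈ V.1, ∃ w ∈ V.1, g = B v w}) (V : U)
    (h : ∀ v ∈ V.1, ∀ w ∈ V.1, B v w ∈ f V) (b : Module.Basis (Fin 2) ℂ V.1)
    (c : f V →ₗ[ℂ] ℂ) (hc : c ⟨B (b 0) (b 1), h _ (b 0).2 _ (b 1).2⟩ = 1) :
    HasDifferentialAt f V (alternatingDifferential B h b c) := by
  intro W hW W' hW'
  let e := (Module.finBasis ℂ (V.1 →ₗ[ℂ] W)).equivFun.symm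
  let e' := (Module.finBasis ℂ (f V →ₗ[ℂ] W')).equivFun
  let π : E' →ₗ[ℂ] W' := W'.projectionOnto (f V) hW'.symm
  let γ : E' →ₗ[ℂ] ℂ := c ∘ₗ (f V).projectionOnto W' hW'
  let G : (V.1 →ₗ[ℂ] W) → E' := fun A => B (b 0 + A (b 0)) (b 1 + A (b 1))
  let p : Fin 2 → (V.1 →ₗ[ℂ] W) →ₗ[ℂ] E := fun i => W.subtype ∘ₗ LinearMap.applyₗ (b i)
  let ℓ : (V.1 →ₗ[ℂ] W) →ₗ[ℂ] E' := B (b 0) ∘ₗ p 1 + B.flip (b 1) ∘ₗ p 0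
  let σ : W' →ₗ[ℂ] (f V →ₗ[ℂ] W') := LinearMap.smulRightₗ c
  have hF : B (b 0) (b 1) ∈ f V := h _ (b 0).2 _ (b 1).2
  have hL : f V = Submodule.span ℂ {B (b 0) (b 1)} := (hf V).trans (span_alternating_basis hB b)
  have hG0 : G (e 0) = B (b 0) (b 1) := by simp [G]
  have hγ0 : γ (G (e 0)) = 1 := by
    rw [hG0]
    change c ((f V).projectionOnto W' hW' _) = 1
    rw [← hc]
    exact congrArg c (Submodule.projectionOnto_apply_left hW' ⟨_, hF⟩)
  have hπ0 : π (G (e 0)) = 0 := by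
    rw [hG0]
    exact (Submodule.projectionOnto_apply_eq_zero_iff hW'.symm).2 hF
  have hγ : HasFDerivAt (fun x => γ (G (e x))) _ 0 :=
    hasFDerivAt_alternating_add B γ (b 0 : E) (b 1) (p 0 ∘ₗ e.toLinearMap) (p 1 ∘ₗ e.toLinearMap)
  have hπ : HasFDerivAt (fun x => e' (σ (π (G (e x)))))
      (LinearMap.toContinuousLinearMap (e'.toLinearMap ∘ₗ (σ ∘ₗ π ∘ₗ ℓ) ∘ₗ e.toLinearMap)) 0 :=
    hasFDerivAt_alternating_add B (e'.toLinearMap ∘ₗ σ ∘ₗ π) (b 0 : E) (b 1)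
      (p 0 ∘ₗ e.toLinearMap) (p 1 ∘ₗ e.toLinearMap)
  -- The affine coordinate of the line spanned by `G A`: its `W'`-component divided by its
  -- `F`-component. `σ` turns a vector `y` of `W'` into the map `F ↦ y`.
  refine ⟨_, _, e, e', fun A => σ ((γ (G A))⁻¹ • π (G A)), σ ∘ₗ π ∘ₗ ℓ, ?_, ?_, ?_⟩
  · have hne := hγ.continuousAt.eventually_ne (hγ0.trans_ne one_ne_zero)
    filter_upwards [hne] with x hx
    have hmem : graph V.1 W (e x) ∈ U := by
      refine hU _ ((finrank_graph hW _).trans ?_) ⟨_, ⟨b 0, rfl⟩, _, ⟨b 1, rfl⟩, fun h0 => hx ?_⟩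
      · rw [Module.finrank_eq_card_basis b, Fintype.card_fin]
      · exact (congrArg γ h0).trans (map_zero γ)
    refine ⟨hmem, ?_⟩
    rw [hf]
    change Submodule.span ℂ {g | ∃ v ∈ graph V.1 W (e x), ∃ w ∈ graph V.1 W (e x), g = B v w} = _
    rw [graph_eq_span_pair b, span_alternating_span_pair hB]
    exact span_singleton_eq_graph hW' hF hL c hc hx
  -- In the product rule, the derivative of `γ⁻¹` is multiplied by `π = 0` and that of `π` by `γ⁻¹ =
  -- 1`.
  · have hinv := (hasDerivAt_inv (hγ0.trans_ne one_ne_zero)).comp_hasFDerivAt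
      (0 : Fin _ → ℂ) hγ
    have hmul := hinv.smul hπ
    refine (hmul.congr_fderiv ?_).congr_of_eventuallyEq
      (Filter.Eventually.of_forall fun x => ?_)
    · have hγ0' : γ (G 0) = 1 := by rwa [map_zero e] at hγ0
      rw [hπ0]
      ext x
      simp [hγ0']
    · simp only [map_smul]
      rfl
  · intro A
    ext u
    change Submodule.Quotient.mk ((c u • π (ℓ A) : W') : E') =
      c u • (Submodule.Quotient.mk (B (b 0) (A (b 1))) -
        Submodule.Quotient.mk (B (b 1) (A (b 0))) : E' ⧸ f V)
    have hℓ : ℓ A = B (b 0) (A (b 1)) - B (b 1) (A (b 0)) := by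
      change B (b 0) (A (b 1)) + B (A (b 0)) (b 1) = _
      rw [alternating_swap hB (b 1 : E) (A (b 0)), sub_eq_add_neg]
    rw [← Submodule.Quotient.mk_sub, ← hℓ, ← Submodule.Quotient.mk_smul, Submodule.Quotient.eq,
      Submodule.coe_smul, ← smul_sub]
    refine Submodule.smul_mem _ _ ?_
    rw [← Submodule.neg_mem_iff, neg_sub]
    -- Projecting to `W'` along `L` does not change the class modulo `L`.
    exact Submodule.sub_projection_mem hW'.symm (ℓ A)

theorem alternating_smul_add_smul (hB : ∀ v, B v v = 0) (s t s' t' : ℂ) (v w : E) :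
    B (s • v + t • w) (s' • v + t' • w) = (s * t' - t * s') • B v w := by
  simp only [map_add, map_smul, LinearMap.add_apply, LinearMap.smul_apply, hB,
    alternating_swap hB v w]
  module

theorem basis_two_apply {V : Submodule ℂ E} (b b' : Module.Basis (Fin 2) ℂ V) (i : Fin 2) :
    b' i = b.toMatrix b' 0 i • b 0 + b.toMatrix b' 1 i • b 1 := by
  rw [← b.sum_toMatrix_smul_self b' i, Fin.sum_univ_two]

theorem alternating_basis_change (hB : ∀ v, B v v = 0) {V : Submodule ℂ E}
    (b b' : Module.Basis (Fin 2) ℂ V) :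
    B (b' 0) (b' 1) = b.det b' • B (b 0) (b 1) := by
  rw [basis_two_apply b b' 0, basis_two_apply b b' 1, Module.Basis.det_apply, Matrix.det_fin_two]
  simp only [Submodule.coe_add, Submodule.coe_smul]
  rw [alternating_smul_add_smul hB]
  congr 1
  ring

/-- Modulo `L`, the first variation of `B (b 0) (b 1)` along `φ` gets multiplied by the determinant
of a change of basis. -/
theorem contractQ_basis_change {V : Submodule ℂ E} {L : Submodule ℂ E'}
    (h : ∀ v ∈ V, ∀ w ∈ V, B v w ∈ L) (b b' : Module.Basis (Fin 2) ℂ V) (φ : GrTangent V) :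
    contractQ B h (b' 0) (φ (b' 1)) - contractQ B h (b' 1) (φ (b' 0)) =
      b.det b' • (contractQ B h (b 0) (φ (b 1)) - contractQ B h (b 1) (φ (b 0))) := by
  have hadd : ∀ (s t : ℂ) (v w : V) (x : E ⧸ V), contractQ B h (s • v + t • w) x =
      s • contractQ B h v x + t • contractQ B h w x := by
    intro s t v w x
    obtain ⟨x, rfl⟩ := Submodule.Quotient.mk_surjective _ x
    simp only [contractQ_mk, ← Submodule.Quotient.mk_smul, ← Submodule.Quotient.mk_add]
    simp
  rw [basis_two_apply b b' 0, basis_two_apply b b' 1, Module.Basis.det_apply, Matrix.det_fin_two]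
  simp only [hadd, map_add, map_smul]
  module

/-- The differential is built from one basis `b`. The formula holds for every `b'` because the
generator of `L` and the variation both scale by `b.det b'`. -/
theorem alternatingDifferential_apply (hB : ∀ v, B v v = 0) {V : Submodule ℂ E}
    {L : Submodule ℂ E'} (h : ∀ v ∈ V, ∀ w ∈ V, B v w ∈ L) (b b' : Module.Basis (Fin 2) ℂ V)
    (c : L →ₗ[ℂ] ℂ) (hc : c ⟨B (b 0) (b 1), h _ (b 0).2 _ (b 1).2⟩ = 1) (φ : GrTangent V) :
    alternatingDifferential B h b c φ ⟨B (b' 0) (b' 1), h _ (b' 0).2 _ (b' 1).2⟩ =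
      contractQ B h (b' 0) (φ (b' 1)) - contractQ B h (b' 1) (φ (b' 0)) := by
  rw [contractQ_basis_change h b b']
  refine (LinearMap.smulRight_apply _ _ _).trans ?_
  congr 1
  have : (⟨B (b' 0) (b' 1), h _ (b' 0).2 _ (b' 1).2⟩ : L) =
      b.det b' • ⟨B (b 0) (b 1), h _ (b 0).2 _ (b 1).2⟩ :=
    Subtype.ext (alternating_basis_change hB b b')
  rw [this, map_smul, hc, smul_eq_mul, mul_one]

end Alternating

open MvPolynomial

/-! ### Homogeneous polynomials -/

section Homogeneous

variable {σ R : Type*} [CommRing R]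

theorem isHomogeneous_of_X_pow_mul {i : σ} {j m : ℕ} {c : MvPolynomial σ R}
    (h : (X i ^ j * c).IsHomogeneous m) : c.IsHomogeneous (m - j) := by
  intro d hd
  have h1 : coeff (Finsupp.single i j + d) (X i ^ j * c) ≠ 0 := by
    rw [X_pow_eq_monomial, coeff_monomial_mul, one_mul]
    exact hd
  have h2 := h h1
  rw [map_add, Finsupp.weight_single, Pi.one_apply, smul_eq_mul, mul_one] at h2
  omega

/-- Covers the case in which the subtraction `m - j` of `isHomogeneous_of_X_pow_mul` truncates; it
is what kills sections of `𝒪(d)` for `d < 0`. -/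
theorem eq_zero_of_isHomogeneous_X_pow_mul {i : σ} {j m : ℕ} {c : MvPolynomial σ R}
    (h : (X i ^ j * c).IsHomogeneous m) (hm : m < j) : c = 0 := by
  ext d
  by_contra hd
  have h1 : coeff (Finsupp.single i j + d) (X i ^ j * c) ≠ 0 := by
    rw [X_pow_eq_monomial, coeff_monomial_mul, one_mul]
    simpa using hd
  have h2 := h h1
  rw [map_add, Finsupp.weight_single, Pi.one_apply, smul_eq_mul, mul_one] at h2
  omega

theorem IsHomogeneous.modMonomial {m : ℕ} {a : MvPolynomial σ R} (h : a.IsHomogeneous m)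
    (s : σ →₀ ℕ) : (a.modMonomial s).IsHomogeneous m := by
  intro d hd
  by_cases hs : s ≤ d
  · exact absurd (coeff_modMonomial_of_le a hs) hd
  · rw [coeff_modMonomial_of_not_le a hs] at hd
    exact h hd

theorem IsHomogeneous.eval_smul {m : ℕ} {a : MvPolynomial σ R} (h : a.IsHomogeneous m) (t : R)
    (p : σ → R) : eval (t • p) a = t ^ m * eval p a := by
  rw [eval_eq, eval_eq, Finset.mul_sum]
  refine Finset.sum_congr rfl fun d hd => ?_
  have hdeg : ∑ i ∈ d.support, d i = m := by
    rw [h.degree_eq_sum_deg_support hd]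
  simp only [Pi.smul_apply, smul_eq_mul, mul_pow, Finset.prod_mul_distrib]
  rw [Finset.prod_pow_eq_pow_sum, hdeg]
  ring

theorem not_X_dvd_X_pow [IsDomain R] {i j : σ} (h : i ≠ j) (k : ℕ) :
    ¬ (X i : MvPolynomial σ R) ∣ X j ^ k := by
  intro hd
  exact h (X_dvd_X.1 (X_prime.dvd_of_dvd_pow hd))

/-- If `X i ^ k` divides `X j ^ k * r - X l ^ k * r'`, and no monomial of `r`, `r'` is divisible
by `X i ^ k`, then the difference vanishes. -/
theorem X_pow_mul_eq_of_dvd {i j l : σ} (hj : j ≠ i) (hl : l ≠ i) {k : ℕ}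
    {a a' : MvPolynomial σ R}
    (h : X i ^ k ∣ X j ^ k * a.modMonomial (Finsupp.single i k) -
      X l ^ k * a'.modMonomial (Finsupp.single i k)) :
    X j ^ k * a.modMonomial (Finsupp.single i k) =
      X l ^ k * a'.modMonomial (Finsupp.single i k) := by
  classical
  -- Multiplication by a power of another variable leaves the exponent of `X i` unchanged, so no
  -- monomial of either product is divisible by `X i ^ k`.
  have key : ∀ (j : σ) (b : MvPolynomial σ R) (d : σ →₀ ℕ), j ≠ i → Finsupp.single i k ≤ d →
      coeff d (X j ^ k * b.modMonomial (Finsupp.single i k)) = 0 := by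
    intro j b d hji hd
    rw [X_pow_eq_monomial, coeff_monomial_mul']
    split_ifs with hjd
    · rw [coeff_modMonomial_of_le, mul_zero]
      rw [Finsupp.single_le_iff] at hd ⊢
      simpa [Finsupp.single_apply, hji] using hd
    · rfl
  rw [← sub_eq_zero]
  ext d
  by_cases hd : Finsupp.single i k ≤ d
  · rw [coeff_sub, key j a d hj hd, key l a' d hl hd, sub_zero, coeff_zero]
  · rw [X_pow_eq_monomial, monomial_one_dvd_iff_modMonomial_eq_zero] at h
    rw [← coeff_modMonomial_of_not_le _ hd, h]

end Homogeneous

/-! ### Sections on charts -/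

theorem toFrac_injective : Function.Injective toFrac :=
  IsFractionRing.injective CoordRing FracField

theorem toFrac_X_ne_zero (i : Fin 3) : toFrac (X i) ≠ 0 := by
  intro h
  exact X_ne_zero (R := ℂ) i (toFrac_injective (h.trans (map_zero _).symm))

/-- The exponent in the denominator of a section on a chart can be chosen large. -/
theorem exists_of_mem_chartO {i j : Fin 3} {d : ℤ} {f : FracField} (hf : f ∈ chartO i j d) :
    ∃ K : ℕ, ∀ k, K ≤ k → ∃ (m : ℕ) (a : CoordRing), a.IsHomogeneous m ∧ (m : ℤ) = d + 2 * k ∧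
      f * toFrac (X i * X j) ^ k = toFrac a := by
  obtain ⟨K, m, a, ha, hm, hfa⟩ := hf
  refine ⟨K, fun k hk => ?_⟩
  obtain ⟨l, rfl⟩ := Nat.exists_eq_add_of_le hk
  refine ⟨m + 2 * l, a * (X i * X j) ^ l,
    ha.mul (((isHomogeneous_X ℂ i).mul (isHomogeneous_X ℂ j)).pow l), by push_cast; linarith, ?_⟩
  rw [pow_add, ← mul_assoc, hfa, map_mul toFrac a, map_pow]

/-- Two charts suffice: a fraction that has both a power of `X 0` and a power of `X 1` as
denominator is a polynomial, since these are coprime. -/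
theorem exists_homogeneous_of_mem_H0O {d : ℤ} {f : FracField} (hf : f ∈ H0O d) :
    ∃ c : CoordRing, c.IsHomogeneous d.toNat ∧ toFrac c = f := by
  have h := (Submodule.mem_iInf _).1 hf
  obtain ⟨k, m, a, ha, hm, hfa⟩ := h 0
  obtain ⟨l, r, b, hb, hr, hfb⟩ := h 1
  have hab : a * X 1 ^ (2 * l) = b * X 0 ^ (2 * k) := by
    apply toFrac_injective
    rw [map_mul toFrac a, map_mul toFrac b, ← hfa, ← hfb]
    simp only [map_mul, map_pow]
    ring
  have hdvd : X 0 ^ (2 * k) ∣ a :=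
    (X_prime (i := 0)).pow_dvd_of_dvd_mul_right _ (not_X_dvd_X_pow (by decide) _)
      (Dvd.intro_left b hab.symm)
  obtain ⟨c, rfl⟩ := hdvd
  have hfc : toFrac c = f := by
    have h0 : toFrac (X 0) ^ (2 * k) ≠ 0 := pow_ne_zero _ (toFrac_X_ne_zero 0)
    apply mul_left_cancel₀ h0
    rw [← map_pow, ← map_mul, ← hfa]
    simp only [map_mul, map_pow]
    ring
  refine ⟨c, ?_, hfc⟩
  rcases lt_or_ge d 0 with hd | hd
  -- For `d < 0`, `m = d + 2 * k` is less than `2 * k`, so `c = 0`, which is homogeneous of the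
  -- default degree `d.toNat = 0`.
  · rw [eq_zero_of_isHomogeneous_X_pow_mul ha (by omega)]
    exact isHomogeneous_zero _ _ _
  · have := isHomogeneous_of_X_pow_mul ha
    rwa [show m - 2 * k = d.toNat by omega] at this

instance (d : ℤ) : FiniteDimensional ℂ (H0O d) := by
  have : FiniteDimensional ℂ (homogeneousSubmodule (Fin 3) ℂ d.toNat) :=
    Module.Finite.iff_fg.2 (homogeneousSubmodule_fg (Fin 3) ℂ d.toNat)
  have hle : H0O d ≤ (homogeneousSubmodule (Fin 3) ℂ d.toNat).map
      (Algebra.linearMap CoordRing FracField |>.restrictScalars ℂ) := by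
    intro f hf
    obtain ⟨c, hc, rfl⟩ := exists_homogeneous_of_mem_H0O hf
    exact ⟨c, hc, rfl⟩
  exact Submodule.finiteDimensional_of_le hle

/-- Global regular functions are constant. -/
theorem exists_const_of_mem_H0O_zero {f : FracField} (hf : f ∈ H0O 0) :
    ∃ t : ℂ, f = algebraMap ℂ FracField t := by
  obtain ⟨c, hc, rfl⟩ := exists_homogeneous_of_mem_H0O hf
  refine ⟨coeff 0 c, ?_⟩
  have : c = C (coeff 0 c) :=
    totalDegree_eq_zero_iff_eq_C.1 ((totalDegree_zero_iff_isHomogeneous _).2 hc)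
  rw [this]
  simp
  rfl

/-- The vanishing of `H¹(ℙ², 𝒪)`. -/
theorem exists_coboundary {g₁ g₂ : FracField} (h₁ : g₁ ∈ chartO 0 1 0) (h₂ : g₂ ∈ chartO 0 2 0)
    (h₁₂ : g₂ - g₁ ∈ chartO 1 2 0) :
    ∃ h ∈ chartO 0 0 0, h - g₁ ∈ chartO 1 1 0 ∧ h - g₂ ∈ chartO 2 2 0 := by
  obtain ⟨K₁, H₁⟩ := exists_of_mem_chartO h₁
  obtain ⟨K₂, H₂⟩ := exists_of_mem_chartO h₂
  obtain ⟨K₃, H₃⟩ := exists_of_mem_chartO h₁₂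
  obtain ⟨k, hk₁, hk₂, hk₃⟩ : ∃ k, K₁ ≤ k ∧ K₂ ≤ k ∧ K₃ ≤ k :=
    ⟨max K₁ (max K₂ K₃), by simp, by simp, by simp⟩
  obtain ⟨m₁, a₁, ha₁, hm₁, e₁⟩ := H₁ k hk₁
  obtain ⟨m₂, a₂, ha₂, hm₂, e₂⟩ := H₂ k hk₂
  obtain ⟨m₃, a₃, ha₃, hm₃, e₃⟩ := H₃ k hk₃
  obtain rfl : m₁ = 2 * k := by omega
  obtain rfl : m₂ = 2 * k := by omega
  -- The numerators over a common exponent `k` are divided by `X 0 ^ k`. The quotients `u₁`, `u₂`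
  -- give the parts of `g₁`, `g₂` without pole along `X 0`; the remainders should give one common
  -- part, regular on `U₀`.
  set s : Fin 3 →₀ ℕ := Finsupp.single 0 k with hs
  have d₁ := divMonomial_add_modMonomial a₁ s
  have d₂ := divMonomial_add_modMonomial a₂ s
  rw [hs, ← X_pow_eq_monomial, ← hs] at d₁ d₂
  set r₁ := a₁.modMonomial s with hr₁
  set r₂ := a₂.modMonomial s with hr₂
  set u₁ := a₁.divMonomial s
  set u₂ := a₂.divMonomial s
  have hX := toFrac_X_ne_zero
  have hrel : X 1 ^ k * a₂ - X 2 ^ k * a₁ = X 0 ^ k * a₃ := by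
    apply toFrac_injective
    rw [map_sub, map_mul, map_mul, map_mul, ← e₁, ← e₂, ← e₃]
    simp only [map_mul, map_pow]
    ring
  -- The cocycle relation modulo `X 0 ^ k` only involves the remainders, and for them the congruence
  -- is an equality. Hence `r₁ = X 1 ^ k * r` and `r₂ = X 2 ^ k * r` with the same `r`, and `r / X 0
  -- ^ k` is the required `h`.
  have hrr : X 1 ^ k * r₂ = X 2 ^ k * r₁ := by
    refine X_pow_mul_eq_of_dvd (by decide) (by decide) ⟨a₃ - X 1 ^ k * u₂ + X 2 ^ k * u₁, ?_⟩
    rw [← hs, ← hr₁, ← hr₂]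
    linear_combination hrel + X 1 ^ k * d₂ - X 2 ^ k * d₁
  obtain ⟨r, hr⟩ : X 1 ^ k ∣ r₁ :=
    (X_prime (i := 1)).pow_dvd_of_dvd_mul_left _ (not_X_dvd_X_pow (j := 2) (by decide) _)
      (Dvd.intro _ hrr)
  have hr' : r₂ = X 2 ^ k * r := by
    have : (X 1 : CoordRing) ^ k ≠ 0 := pow_ne_zero _ (X_ne_zero 1)
    apply mul_left_cancel₀ this
    rw [hrr, hr]
    ring
  have hom_r : r.IsHomogeneous k := by
    have h := IsHomogeneous.modMonomial ha₁ s
    rw [← hr₁, hr] at h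
    have := isHomogeneous_of_X_pow_mul h
    rwa [show 2 * k - k = k by omega] at this
  have hom_u : ∀ {a r u : CoordRing}, a.IsHomogeneous (2 * k) → r.IsHomogeneous (2 * k) →
      X 0 ^ k * u + r = a → u.IsHomogeneous k := by
    intro a r u ha hr h
    have h' := ha.sub hr
    rw [← h, add_sub_cancel_right] at h'
    have := isHomogeneous_of_X_pow_mul h'
    rwa [show 2 * k - k = k by omega] at this
  have hom_u₁ : u₁.IsHomogeneous k := hom_u ha₁ (IsHomogeneous.modMonomial ha₁ s) d₁
  have hom_u₂ : u₂.IsHomogeneous k := hom_u ha₂ (IsHomogeneous.modMonomial ha₂ s) d₂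
  have mem : ∀ (i : Fin 3) (c : CoordRing), c.IsHomogeneous k →
      toFrac c / toFrac (X i) ^ k ∈ chartO i i 0 := by
    intro i c hc
    refine ⟨k, k + k, c * X i ^ k, hc.mul (isHomogeneous_X_pow i k), by push_cast; ring, ?_⟩
    have := pow_ne_zero k (hX i)
    simp only [map_mul, map_pow, mul_pow]
    field_simp
  have h0 := hX 0
  have h1 := hX 1
  have h2 := hX 2
  have f₁ : g₁ = toFrac u₁ / toFrac (X 1) ^ k + toFrac r / toFrac (X 0) ^ k := by
    rw [← d₁, hr] at e₁
    simp only [map_mul, map_pow, map_add, mul_pow] at e₁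
    field_simp
    linear_combination e₁
  have f₂ : g₂ = toFrac u₂ / toFrac (X 2) ^ k + toFrac r / toFrac (X 0) ^ k := by
    rw [← d₂, hr'] at e₂
    simp only [map_mul, map_pow, map_add, mul_pow] at e₂
    field_simp
    linear_combination e₂
  refine ⟨_, mem 0 r hom_r, ?_, ?_⟩
  · rw [f₁, sub_add_cancel_right]
    exact Submodule.neg_mem _ (mem 1 u₁ hom_u₁)
  · rw [f₂, sub_add_cancel_right]
    exact Submodule.neg_mem _ (mem 2 u₂ hom_u₂)

/-! ### Restriction of sections to a curve -/

theorem mem_idealO {d : ℤ} {L : Submodule ℂ (H0O d)} {F : H0O d}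
    (hL : L = Submodule.span ℂ {F}) {i j : Fin 3} {f : FracField} :
    f ∈ idealO d L i j ↔ ∃ g ∈ chartO i j 0, f = F * g := by
  rw [idealO, hL, Submodule.map_span, Set.image_singleton, Submodule.mem_span_singleton_mul]
  simp only [eq_comm, Submodule.subtype_apply]

/-- If `f` vanishes on `C`, then `f / F` is regular on every chart, hence constant. -/
theorem ker_restrict {d : ℤ} {L : Submodule ℂ (H0O d)} {F : H0O d} (hF : F ≠ 0)
    (hL : L = Submodule.span ℂ {F}) : LinearMap.ker (restrict d L) = L := by
  refine le_antisymm (fun f hf => ?_) (le_ker_restrict d L)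
  have hF' : (F : FracField) ≠ 0 := fun h => hF (Subtype.ext h)
  rw [LinearMap.mem_ker, restrict, LinearMap.comp_apply, Submodule.mkQ_apply,
    Submodule.Quotient.mk_eq_zero] at hf
  have hf' : ∀ i, (f : FracField) ∈ idealO d L i i := fun i => hf i (Set.mem_univ i)
  have hg : (f : FracField) / F ∈ H0O 0 := by
    refine (Submodule.mem_iInf _).2 fun i => ?_
    obtain ⟨g, hg, hfg⟩ := (mem_idealO hL).1 (hf' i)
    rwa [hfg, mul_div_cancel_left₀ _ hF']
  obtain ⟨t, ht⟩ := exists_const_of_mem_H0O_zero hg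
  rw [hL]
  refine Submodule.mem_span_singleton.2 ⟨t, Subtype.ext ?_⟩
  rw [Submodule.coe_smul, Algebra.smul_def, ← ht, div_mul_cancel₀ _ hF']

/-- Local lifts satisfy `a i - a j = F * g`, and these `g` form a cocycle of regular functions
because `F` can be cancelled. Writing it as the coboundary of `k`, the corrected lifts `a i - F * k
i` glue. -/
theorem restrict_surjective {d : ℤ} {L : Submodule ℂ (H0O d)} {F : H0O d} (hF : F ≠ 0)
    (hL : L = Submodule.span ℂ {F}) : Function.Surjective (restrict d L) := by
  intro α
  obtain ⟨⟨a, ha, hco⟩, rfl⟩ := Submodule.Quotient.mk_surjective _ α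
  have hF' : (F : FracField) ≠ 0 := fun h => hF (Subtype.ext h)
  obtain ⟨g₁, hg₁, e₁⟩ := (mem_idealO hL).1 (hco 0 1)
  obtain ⟨g₂, hg₂, e₂⟩ := (mem_idealO hL).1 (hco 0 2)
  obtain ⟨g₃, hg₃, e₃⟩ := (mem_idealO hL).1 (hco 1 2)
  have hsub : g₂ - g₁ = g₃ := by
    apply mul_left_cancel₀ hF'
    linear_combination e₁ - e₂ + e₃
  obtain ⟨h, h₀, h₁, h₂⟩ := exists_coboundary hg₁ hg₂ (hsub ▸ hg₃)
  have hFmul : ∀ {i : Fin 3} {g : FracField}, g ∈ chartO i i 0 → F * g ∈ chartO i i d := by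
    intro i g hg
    have := mul_mem_chartO ((Submodule.mem_iInf _).1 F.2 i) hg
    rwa [add_zero] at this
  let k : Fin 3 → FracField := ![h, h - g₁, h - g₂]
  have hk : ∀ i, k i ∈ chartO i i 0 := by
    intro i
    fin_cases i
    exacts [h₀, h₁, h₂]
  have hak : ∀ i, a i - F * k i = a 0 - F * h := by
    intro i
    fin_cases i
    · rfl
    · change a 1 - F * (h - g₁) = _
      linear_combination - e₁
    · change a 2 - F * (h - g₂) = _
      linear_combination - e₂
  have hf : a 0 - F * h ∈ H0O d := by
    refine (Submodule.mem_iInf _).2 fun i => ?_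
    rw [← hak i]
    exact Submodule.sub_mem _ (ha i) (hFmul (hk i))
  refine ⟨⟨_, hf⟩, ?_⟩
  rw [restrict, LinearMap.comp_apply, Submodule.mkQ_apply, Submodule.Quotient.eq]
  intro i _
  change (a 0 - F * h) - a i ∈ idealO d L i i
  refine (mem_idealO hL).2 ⟨- k i, Submodule.neg_mem _ (hk i), ?_⟩
  rw [← hak i]
  ring

theorem nonempty_basis_of_finrank_eq_two {E : Type*} [AddCommGroup E] [Module ℂ E]
    {V : Submodule ℂ E} (hV : Module.finrank ℂ V = 2) :
    Nonempty (Module.Basis (Fin 2) ℂ V) := by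
  have : FiniteDimensional ℂ V := Module.finite_of_finrank_pos (hV.symm ▸ Nat.zero_lt_two)
  exact ⟨Module.finBasisOfFinrankEq ℂ V hV⟩

theorem exists_linearMap_eq_one {E : Type*} [AddCommGroup E] [Module ℂ E] {x : E} (hx : x ≠ 0) :
    ∃ c : E →ₗ[ℂ] ℂ, c x = 1 := by
  obtain ⟨c, hc⟩ := Module.Projective.exists_dual_ne_zero ℂ hx
  exact ⟨(c x)⁻¹ • c, by simp [hc]⟩

/-- A map out of a line is determined by an arbitrary value at the generator `F`, and restriction to
`C` identifies `H⁰(𝒪(d)) / L` with the sections on `C`. -/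
theorem bijective_tangentToCurve {d : ℤ} {L : Submodule ℂ (H0O d)} {F : H0O d} (hF : F ≠ 0)
    (hL : L = Submodule.span ℂ {F}) (hFL : F ∈ L) :
    Function.Bijective (tangentToCurve d L ⟨F, hFL⟩) := by
  have hspan : ∀ u : L, ∃ t : ℂ, u = t • ⟨F, hFL⟩ := by
    intro u
    have hu : (u : H0O d) ∈ Submodule.span ℂ {F} := hL ▸ u.2
    obtain ⟨t, ht⟩ := Submodule.mem_span_singleton.1 hu
    exact ⟨t, Subtype.ext ht.symm⟩
  obtain ⟨c, hc⟩ := exists_linearMap_eq_one (x := (⟨F, hFL⟩ : L))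
    fun h => hF (congrArg Subtype.val h)
  have hbij : Function.Bijective (L.liftQ (restrict d L) (le_ker_restrict d L)) := by
    constructor
    · rw [← LinearMap.ker_eq_bot]
      exact Submodule.ker_liftQ_eq_bot _ _ _ (ker_restrict hF hL).le
    · rw [← LinearMap.range_eq_top, Submodule.range_liftQ, LinearMap.range_eq_top]
      exact restrict_surjective hF hL
  refine hbij.comp ⟨fun ψ ψ' h => ?_, fun q => ?_⟩
  · ext u
    obtain ⟨t, rfl⟩ := hspan u
    rw [map_smul, map_smul]
    exact congrArg (t • ·) h
  · refine ⟨c.smulRight q, ?_⟩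
    change c ⟨F, hFL⟩ • q = q
    rw [hc, one_smul]

/-! ### Sections of `T(n)` -/

/-- The wedge product of a section of `T(n)` and a constant vector. -/
theorem wedgeGeneric_single_mem {n : ℤ} {v : TGeneric} (hv : v ∈ H0T n) (j : Fin 3) :
    wedgeGeneric v (tmk (Pi.single j 1)) ∈ H0O (n + 2) := by
  refine (Submodule.mem_iInf _).2 fun i => ?_
  obtain ⟨a, ha, rfl⟩ := (Submodule.mem_iInf _).1 hv i
  have key : ∀ p q, a p * euler q ∈ chartO i i (n + 2) := by
    intro p q
    have h := mul_mem_chartO (ha p (Set.mem_univ p)) (X_mem_chartO i i q)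
    rw [add_assoc] at h
    exact h
  change wedgeGeneric (tmk a) _ ∈ _
  rw [wedgeGeneric_tmk, Matrix.det_fin_three]
  fin_cases j <;> simp [-map_mul]
  · exact Submodule.add_mem _ (Submodule.neg_mem _ (key 1 2)) (key 2 1)
  · exact Submodule.sub_mem _ (key 0 2) (key 2 0)
  · exact Submodule.add_mem _ (Submodule.neg_mem _ (key 0 1)) (key 1 0)

/-- Up to sign, the three wedges are the entries of the cross product of a representative with `x`;
if they vanish, the representative is a multiple of `x`. -/
theorem eq_zero_of_wedgeGeneric_single {v : TGeneric}
    (h : ∀ j, wedgeGeneric v (tmk (Pi.single j 1)) = 0) : v = 0 := by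
  obtain ⟨a, rfl⟩ := Submodule.mkQ_surjective _ v
  have h0 := h 0
  have h1 := h 1
  have h2 := h 2
  change wedgeGeneric (tmk a) _ = 0 at h0 h1 h2
  rw [wedgeGeneric_tmk, Matrix.det_fin_three] at h0 h1 h2
  simp at h0 h1 h2
  rw [Submodule.mkQ_apply, Submodule.Quotient.mk_eq_zero, Submodule.mem_span_singleton]
  have hX : euler 0 ≠ 0 := toFrac_X_ne_zero 0
  refine ⟨a 0 / euler 0, funext fun i => ?_⟩
  rw [Pi.smul_apply, smul_eq_mul]
  fin_cases i <;> simp <;> field_simp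
  · linear_combination - h2
  · linear_combination h1

instance (n : ℤ) : FiniteDimensional ℂ (H0T n) := by
  let T : H0T n →ₗ[ℂ] (Fin 3 → H0O (n + 2)) := LinearMap.pi fun j =>
    ((wedgeGeneric.flip (tmk (Pi.single j 1))).restrictScalars ℂ ∘ₗ (H0T n).subtype).codRestrict
      (H0O (n + 2)) fun v => wedgeGeneric_single_mem v.2 j
  refine FiniteDimensional.of_injective T ?_
  rw [← LinearMap.ker_eq_bot, LinearMap.ker_eq_bot']
  intro v hv
  refine Subtype.ext (eq_zero_of_wedgeGeneric_single fun j => ?_)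
  exact congrArg Subtype.val (congrFun hv j)

/-- A section of `T(n)` over `ℙ²` is over `U_i` the class of a vector with entries of the form
`a / x_i ^ k`. -/
theorem exists_numerator {n : ℤ} {v : TGeneric} (hv : v ∈ H0T n) (i : Fin 3) :
    ∃ (k m : ℕ) (a : Fin 3 → CoordRing), (∀ j, (a j).IsHomogeneous m) ∧ (m : ℤ) = n + 1 + k ∧
      v = tmk (fun j => toFrac (a j) / toFrac (X i) ^ k) := by
  obtain ⟨f, hf, rfl⟩ := (Submodule.mem_iInf _).1 hv i
  choose K hK using fun j => exists_of_mem_chartO (hf j (Set.mem_univ j))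
  choose m a ha hm hfa using fun j => hK j (∑ j, K j)
    (Finset.single_le_sum (fun _ _ => Nat.zero_le _) (Finset.mem_univ j))
  have hm' : ∀ j, m j = m 0 := fun j => by
    have := hm j
    have := hm 0
    omega
  -- The sum of the `K j` is a common exponent for the three entries; it doubles because `chartO i
  -- i` has denominators `(x_i x_i) ^ k`.
  refine ⟨2 * ∑ j, K j, m 0, a, fun j => hm' j ▸ ha j, by rw [hm]; push_cast; ring, ?_⟩
  refine congrArg tmk (funext fun j => ?_)
  rw [eq_div_iff (pow_ne_zero _ (toFrac_X_ne_zero i)), ← hfa]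
  simp only [map_mul, pow_mul, sq]

theorem linearIndependent_quotient_of_det_ne_zero {p a b : Fin 3 → ℂ}
    (h : Matrix.det (Matrix.of ![a, b, p]) ≠ 0) :
    LinearIndependent ℂ ![(Submodule.Quotient.mk a : (Fin 3 → ℂ) ⧸ Submodule.span ℂ {p}),
      Submodule.Quotient.mk b] := by
  rw [LinearIndependent.pair_iff]
  intro s t hst
  rw [← Submodule.Quotient.mk_smul, ← Submodule.Quotient.mk_smul, ← Submodule.Quotient.mk_add,
    Submodule.Quotient.mk_eq_zero, Submodule.mem_span_singleton] at hst
  obtain ⟨r, hr⟩ := hst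
  have hv : Matrix.vecMul ![s, t, -r] (Matrix.of ![a, b, p]) = 0 := by
    funext j
    have := congrFun hr j
    simp at this
    simp [Matrix.vecMul, dotProduct, Fin.sum_univ_three]
    linear_combination - this
  have h0 := Matrix.eq_zero_of_vecMul_eq_zero h hv
  exact ⟨congrFun h0 0, congrFun h0 1⟩

/-- If the wedge product of two sections is not zero, then their values at some point are
linearly independent. -/
theorem exists_independent_values {n : ℤ} {v w : H0T n} (h : wedge n v w ≠ 0) :
    ∃ (P : ℙ ℂ (Fin 3 → ℂ)), ∃ w₁ w₂, HasValueAt n v P w₁ ∧ HasValueAt n w P w₂ ∧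
      LinearIndependent ℂ ![w₁, w₂] := by
  obtain ⟨k, m, a, ha, hm, hv⟩ := exists_numerator v.2 0
  obtain ⟨l, r, b, hb, hr, hw⟩ := exists_numerator w.2 0
  -- The factor `X 0` forces the point at which the product does not vanish to lie in `U₀`, where
  -- both representatives are defined.
  have hdet : X 0 * Matrix.det (Matrix.of ![a, b, fun t => X t]) ≠ 0 := by
    refine mul_ne_zero (X_ne_zero 0) fun h0 => h (Subtype.ext ?_)
    have hvec : ∀ (c : Fin 3 → CoordRing) (k : ℕ),
        (fun j => toFrac (c j) / toFrac (X 0) ^ k) =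
        (toFrac (X 0) ^ k)⁻¹ • (fun j => toFrac (c j)) := by
      intro c k; funext j; simp [div_eq_inv_mul]
    have h1 : wedgeGeneric (tmk fun j => toFrac (a j)) (tmk fun j => toFrac (b j)) = 0 := by
      rw [wedgeGeneric_tmk, ← map_zero toFrac, ← h0, RingHom.map_det]
      congr 1
      ext s t
      fin_cases s <;> rfl
    rw [wedge_coe, hv, hw, hvec, hvec, map_smul, map_smul, map_smul, map_smul,
      LinearMap.smul_apply, h1, smul_zero, smul_zero]
    rfl
  obtain ⟨p, hp⟩ : ∃ p, eval p (X 0 * Matrix.det (Matrix.of ![a, b, fun t => X t])) ≠ 0 := by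
    by_contra! hall
    exact hdet (MvPolynomial.funext fun p => by rw [hall, map_zero])
  rw [map_mul, eval_X] at hp
  have hp0 : p 0 ≠ 0 := left_ne_zero_of_mul hp
  have hpne : p ≠ 0 := fun h0 => hp0 (congrFun h0 0)
  obtain ⟨u, hu⟩ := Projectivization.exists_smul_eq_mk_rep ℂ p hpne
  set P := Projectivization.mk ℂ p hpne
  have hu0 : (u : ℂ) ≠ 0 := u.ne_zero
  have hrep : P.rep = (u : ℂ) • p := hu.symm
  have hP0 : P.rep 0 ≠ 0 := by
    rw [hrep]
    exact mul_ne_zero hu0 hp0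
  refine ⟨P, _, _, ⟨0, k, m, a, hP0, ha, hm, hv, rfl⟩, ⟨0, l, r, b, hP0, hb, hr, hw, rfl⟩, ?_⟩
  apply linearIndependent_quotient_of_det_ne_zero
  -- `P.rep` is only a multiple `u • p` of the chosen coordinates; by homogeneity the determinant
  -- changes by a nonzero factor.
  have hrow : (Matrix.of ![fun j => eval P.rep (a j) / P.rep 0 ^ k,
      fun j => eval P.rep (b j) / P.rep 0 ^ l, P.rep]).det =
      ((u : ℂ) ^ m / P.rep 0 ^ k) * ((u : ℂ) ^ r / P.rep 0 ^ l) * u *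
        eval p (Matrix.det (Matrix.of ![a, b, fun t => X t])) := by
    simp only [Matrix.det_fin_three, Matrix.of_apply, Matrix.cons_val, map_sub, map_add, map_mul,
      eval_X]
    simp only [hrep, IsHomogeneous.eval_smul (ha _), IsHomogeneous.eval_smul (hb _), Pi.smul_apply, smul_eq_mul]
    ring
  rw [hrow]
  exact mul_ne_zero (mul_ne_zero (mul_ne_zero (div_ne_zero (pow_ne_zero _ hu0)
    (pow_ne_zero _ hP0)) (div_ne_zero (pow_ne_zero _ hu0) (pow_ne_zero _ hP0))) hu0)
    (right_ne_zero_of_mul hp)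

/-! ### Application to `Φ_n` -/

/-- Converse to `wedge_ne_zero`: together they make GPLI the nonvanishing of a wedge, an open
condition. -/
theorem mem_GPLI {n : ℤ} {V : Submodule ℂ (H0T n)} (hV : Module.finrank ℂ V = 2)
    (h : ∃ v ∈ V, ∃ w ∈ V, wedge n v w ≠ 0) : V ∈ GPLI n := by
  obtain ⟨v, hv, w, hw, hvw⟩ := h
  obtain ⟨P, w₁, w₂, h₁, h₂, hlin⟩ := exists_independent_values hvw
  exact ⟨hV, P, v, hv, w, hw, w₁, w₂, h₁, h₂, hlin⟩

theorem Phi_submodule {n : ℤ} (V : GPLI n) : (Phi n V).submodule = wedgeLine n V := by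
  rw [Phi, Projectivization.submodule_mk'']

theorem Phi_submodule_eq_span {n : ℤ} (V : GPLI n) (b : Module.Basis (Fin 2) ℂ V.1) :
    (Phi n V).submodule = Submodule.span ℂ {wedge n (b 0) (b 1)} :=
  (Phi_submodule V).trans (span_alternating_basis (wedge_self n) b)

theorem wedge_basis_ne_zero {n : ℤ} (V : GPLI n) (b : Module.Basis (Fin 2) ℂ V.1) :
    wedge n (b 0) (b 1) ≠ 0 := by
  intro h0
  have h := finrank_wedgeLine n V
  rw [← Phi_submodule, Phi_submodule_eq_span V b, h0, Submodule.span_zero_singleton,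
    finrank_bot] at h
  exact zero_ne_one h

theorem wedge_mem_Phi {n : ℤ} (V : GPLI n) :
    ∀ v ∈ V.1, ∀ w ∈ V.1, wedge n v w ∈ (Phi n V).submodule :=
  fun v hv w hw => wedge_mem n V ⟨v, hv⟩ ⟨w, hw⟩

set_option maxHeartbeats 1000000 in
/-- The restriction to `C` of the first variation of `b 0 ∧ b 1`. -/
theorem restrict_variation {n : ℤ} (V : GPLI n) (b : Module.Basis (Fin 2) ℂ V.1)
    (φ : GrTangent V.1) (w : Fin 2 → H0T n)
    (hw : ∀ i, Submodule.Quotient.mk (w i) = φ (b i)) :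
    restrict (2 * n + 3) (Phi n V).submodule (wedge n (b 0) (w 1) - wedge n (b 1) (w 0)) =
      (Phi n V).submodule.liftQ _ (le_ker_restrict _ _)
        (contractQ (wedge n) (wedge_mem_Phi V) (b 0) (φ (b 1)) -
          contractQ (wedge n) (wedge_mem_Phi V) (b 1) (φ (b 0))) := by
  rw [← hw 0, ← hw 1, contractQ_mk, contractQ_mk, ← Submodule.Quotient.mk_sub,
    Submodule.liftQ_apply]

set_option maxHeartbeats 2000000 in
theorem exists_hasDifferentialAt_Phi {n : ℤ} (V : GPLI n) :
    ∃ D : GrTangent V.1 →ₗ[ℂ] GrTangent (Phi n V).submodule,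
      HasDifferentialAt (fun V' => (Phi n V').submodule) V D ∧
      ∀ (b : Module.Basis (Fin 2) ℂ V.1) (φ : GrTangent V.1),
        D φ ⟨wedge n (b 0) (b 1), wedge_mem n V (b 0) (b 1)⟩ =
          contractQ (wedge n) (wedge_mem_Phi V) (b 0) (φ (b 1)) -
            contractQ (wedge n) (wedge_mem_Phi V) (b 1) (φ (b 0)) := by
  obtain ⟨b₀⟩ := nonempty_basis_of_finrank_eq_two V.2.1
  obtain ⟨c, hc⟩ := exists_linearMap_eq_one
    (x := (⟨wedge n (b₀ 0) (b₀ 1), wedge_mem n V (b₀ 0) (b₀ 1)⟩ : (Phi n V).submodule))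
    fun h0 => wedge_basis_ne_zero V b₀ (congrArg Subtype.val h0)
  refine ⟨alternatingDifferential (wedge n) (wedge_mem_Phi V) b₀ c, ?_, fun b φ => ?_⟩
  · exact hasDifferentialAt_alternating (wedge_self n) (fun _ => mem_GPLI) Phi_submodule V
      (wedge_mem_Phi V) b₀ c hc
  · exact alternatingDifferential_apply (wedge_self n) (wedge_mem_Phi V) b₀ b c hc φ

end PlaneTangent

end

set_option maxHeartbeats 2000000 in
theorem mainTheorem9 (n : ℤ) (hn : -1 ≤ n) (V : PlaneTangent.GPLI n) :
    ∃ D : PlaneTangent.GrTangent V.1 →ₗ[ℂ]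
        PlaneTangent.GrTangent (PlaneTangent.Phi n V).submodule,
      -- `D` is the differential of `Φ_n` at `V`
      PlaneTangent.HasDifferentialAt (fun V' => (PlaneTangent.Phi n V').submodule) V D ∧
      (∀ D', PlaneTangent.HasDifferentialAt (fun V' => (PlaneTangent.Phi n V').submodule) V D' →
        D' = D) ∧
      -- the equation `b 0 ∧ b 1` of `C` identifies the target of `D` with `H⁰(C, 𝒪(2n+3)|_C)`
      (∀ b : Module.Basis (Fin 2) ℂ V.1, Function.Bijective
        (PlaneTangent.tangentToCurve (2 * n + 3) (PlaneTangent.Phi n V).submodule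
          ⟨PlaneTangent.wedge n (b 0) (b 1), PlaneTangent.wedge_mem n V (b 0) (b 1)⟩)) ∧
      -- the formula, for every basis `b` of `V` and all lifts `w i` of `φ (b i)`
      (∀ (b : Module.Basis (Fin 2) ℂ V.1) (φ : PlaneTangent.GrTangent V.1)
        (w : Fin 2 → PlaneTangent.H0T n), (∀ i, Submodule.Quotient.mk (w i) = φ (b i)) →
        PlaneTangent.tangentToCurve (2 * n + 3) (PlaneTangent.Phi n V).submodule
            ⟨PlaneTangent.wedge n (b 0) (b 1), PlaneTangent.wedge_mem n V (b 0) (b 1)⟩ (D φ) =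
          PlaneTangent.restrict (2 * n + 3) (PlaneTangent.Phi n V).submodule
            (PlaneTangent.wedge n (b 0) (w 1) - PlaneTangent.wedge n (b 1) (w 0))) ∧
      -- a change of basis multiplies the expression and the equation of `C` by the same scalar
      (∀ (b b' : Module.Basis (Fin 2) ℂ V.1) (φ : PlaneTangent.GrTangent V.1)
        (w w' : Fin 2 → PlaneTangent.H0T n),
        (∀ i, Submodule.Quotient.mk (w i) = φ (b i)) →
        (∀ i, Submodule.Quotient.mk (w' i) = φ (b' i)) →
        PlaneTangent.wedge n (b' 0) (b' 1) = b.det b' • PlaneTangent.wedge n (b 0) (b 1) ∧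
        PlaneTangent.restrict (2 * n + 3) (PlaneTangent.Phi n V).submodule
            (PlaneTangent.wedge n (b' 0) (w' 1) - PlaneTangent.wedge n (b' 1) (w' 0)) =
          b.det b' • PlaneTangent.restrict (2 * n + 3) (PlaneTangent.Phi n V).submodule
            (PlaneTangent.wedge n (b 0) (w 1) - PlaneTangent.wedge n (b 1) (w 0))) := by
  obtain ⟨D, hD, hformula⟩ := PlaneTangent.exists_hasDifferentialAt_Phi V
  refine ⟨D, hD, fun D' hD' => hD.unique hD', fun b => ?_, fun b φ w hw => ?_,
    fun b b' φ w w' hw hw' =>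
      ⟨PlaneTangent.alternating_basis_change (PlaneTangent.wedge_self n) b b', ?_⟩⟩
  · exact PlaneTangent.bijective_tangentToCurve (PlaneTangent.wedge_basis_ne_zero V b)
      (PlaneTangent.Phi_submodule_eq_span V b) _
  · rw [PlaneTangent.restrict_variation V b φ w hw, ← hformula b φ]
    rfl
  · rw [PlaneTangent.restrict_variation V b φ w hw, PlaneTangent.restrict_variation V b' φ w' hw',
      PlaneTangent.contractQ_basis_change (PlaneTangent.wedge_mem_Phi V) b b', map_smul]
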